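/- Let $T>0$, let $(\Omega,\mathcal F_T,P)$ be a probability space with a filtration $(\mathcal F_t)_{t\in[0,T]}$ (so $\mathcal F_t\subseteq\mathcal F_T$), and fix $t\in[0,T]$. For a sub-$\sigma$-algebra $\mathcal G$ write $L^0(\mathbb R,\mathcal G)$ (resp. $L^0(\mathbb R_+,\mathcal G)$) for the set of $P$-a.s. equivalence classes of real-valued (resp. nonnegative) $\mathcal G$-measurable random variables; inequalities between random variables hold $P$-a.s. Let $\mathcal O_t$ be a topology on $L^0(\mathbb R,\mathcal F_T)$ such that, whenever a sequence $(X^n)_{n\ge1}$ converges to $X$ in $\mathcal O_t$: (a) (Fatou property) $X\le\liminf_n X^{k_n}$ for some subsequence $(k_n)_{n\ge 1}$; (b) ($\mathcal F_t$-positive homogeneity) $\alpha_tX^n\to\alpha_tX$ in $\mathcal O_t$ for every $\alpha_t\in L^0(\mathbb R_+,\mathcal F_t)$; (c) ($\mathcal F_t$-lower bound preservation) if $X\ge m_t$ for some $m_t\in L^0(\mathbb R,\mathcal F_t)$, then there are a subsequence $(k_n)_{n\ge1}$ and $\mu_t\in L^0(\mathbb R,\mathcal F_t)$ with $X^{k_n}\ge\mu_t$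 for all $n$. Let $\mathcal V_{t,T}\subseteq L^0(\mathbb R,\mathcal F_T)$ (the terminal discrete-time portfolios) be a nonempty $\mathcal F_t$-positive cone, i.e. $\mathcal V_{t,T}$ is convex and $\alpha_t\mathcal V_{t,T}\subseteq\mathcal V_{t,T}$ for all $\alpha_t\in L^0(\mathbb R_+,\mathcal F_t)$. Let $\mathcal V_{t,T}^c$ (the terminal continuous-time portfolios) be the set of all $\mathcal O_t$-limits of $\mathcal O_t$-convergent sequences of elements of $\mathcal V_{t,T}$. For $\mathcal V\in\{\mathcal V_{t,T},\mathcal V^c_{t,T}\}$ say that NFL (no free lunch) holds at time $t$ for $\mathcal V$ if $$\overline{\bigl(\mathcal V-L^0(\mathbb R_+,\mathcal F_T)\bigr)\cap L^\infty(\mathbb R,\mathcal F_T)}^{\,\sigma(L^\infty,L^1)}\cap L^\infty(\mathbb R_+,\mathcal F_T)=\{0\}.$$ Then the following statements are equivalent: 1. NFL holds at time $t$ for the discrete-time portfolios $\mathcal V_{t,T}$. 2. There exists a probability measure $Q_t\sim P$ such that $E_{Q_t}(V)\le0$ for all $V\in\mathcal V_{t,T}$ that are bounded from below by a constant. 3.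 NFL holds at time $t$ for the continuous-time portfolios $\mathcal V^c_{t,T}$. 4. There exists a probability measure $Q_t\sim P$ such that $E_{Q_t}(V)\le0$ for all $V\in\mathcal V^c_{t,T}$ that are bounded from below by a constant. (For $V$ bounded from below, $E_{Q_t}(V)\in(-\infty,+\infty]$ is always defined; $E_{Q_t}(V)\le 0$ includes that $V$ is $Q_t$-integrable.) -/

import Mathlib

open MeasureTheory Filter
open scoped ENNReal Pointwise

namespace NoFreeLunch

/-!
Throughout, `Ω →ₘ[P] ℝ` is the space `L^0(ℝ, 𝓕_T)` of `P`-a.e. equivalence classes of real random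
variables on `(Ω, 𝓕_T, P)`, where `𝓕_T` is the ambient σ-algebra, with its a.e. order.
-/

/-- `X` belongs to `L^0(ℝ, m)`: the class `X` has an `m`-measurable representative. -/
def MeasurableClass {Ω : Type*} (m : MeasurableSpace Ω) {mΩ : MeasurableSpace Ω}
    {P : Measure Ω} (X : Ω →ₘ[P] ℝ) : Prop :=
  AEStronglyMeasurable[m] X P

/-- The Fatou property of a topology `O` on `L^0`: if `X n → X` in `O`, then `X ≤ liminf X (k n)`
almost surely along some subsequence. The limit inferior is taken in `[-∞, ∞]`. -/
def FatouProperty {Ω : Type*} {mΩ : MeasurableSpace Ω} {P : Measure Ω}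
    (O : TopologicalSpace (Ω →ₘ[P] ℝ)) : Prop :=
  ∀ (Xs : ℕ → Ω →ₘ[P] ℝ) (X : Ω →ₘ[P] ℝ), Tendsto Xs atTop (@nhds _ O X) →
    ∃ k : ℕ → ℕ, StrictMono k ∧
      ∀ᵐ ω ∂P, ((X ω : ℝ) : EReal) ≤ liminf (fun n => ((Xs (k n) ω : ℝ) : EReal)) atTop

/-- `m`-positive homogeneity of a topology `O` on `L^0`. -/
def PositivelyHomogeneous {Ω : Type*} (m : MeasurableSpace Ω) {mΩ : MeasurableSpace Ω}
    {P : Measure Ω} (O : TopologicalSpace (Ω →ₘ[P] ℝ)) : Prop :=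
  ∀ (Xs : ℕ → Ω →ₘ[P] ℝ) (X : Ω →ₘ[P] ℝ), Tendsto Xs atTop (@nhds _ O X) →
    ∀ α : Ω →ₘ[P] ℝ, MeasurableClass m α → 0 ≤ α →
      Tendsto (fun n => α * Xs n) atTop (@nhds _ O (α * X))

/-- `m`-lower bound preservation of a topology `O` on `L^0`. -/
def LowerBoundPreserving {Ω : Type*} (m : MeasurableSpace Ω) {mΩ : MeasurableSpace Ω}
    {P : Measure Ω} (O : TopologicalSpace (Ω →ₘ[P] ℝ)) : Prop :=
  ∀ X : Ω →ₘ[P] ℝ, (∃ l : Ω →ₘ[P] ℝ, MeasurableClass m l ∧ l ≤ X) →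
    ∀ Xs : ℕ → Ω →ₘ[P] ℝ, Tendsto Xs atTop (@nhds _ O X) →
      ∃ k : ℕ → ℕ, StrictMono k ∧
        ∃ l : Ω →ₘ[P] ℝ, MeasurableClass m l ∧ ∀ n, l ≤ Xs (k n)

/-- `V` is an `m`-positive cone: it is convex and stable under multiplication by nonnegative
`m`-measurable random variables. -/
structure IsPositiveCone {Ω : Type*} (m : MeasurableSpace Ω) {mΩ : MeasurableSpace Ω}
    {P : Measure Ω} (V : Set (Ω →ₘ[P] ℝ)) : Prop where
  convex : Convex ℝ V
  mul_mem : ∀ α : Ω →ₘ[P] ℝ, MeasurableClass m α → 0 ≤ α → ∀ X ∈ V, α * X ∈ V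

/-- The terminal continuous-time portfolios generated by the discrete-time ones `V`: all limits in
`O` of `O`-convergent sequences of elements of `V`. -/
def continuousPortfolios {Ω : Type*} {mΩ : MeasurableSpace Ω} {P : Measure Ω}
    (O : TopologicalSpace (Ω →ₘ[P] ℝ)) (V : Set (Ω →ₘ[P] ℝ)) : Set (Ω →ₘ[P] ℝ) :=
  {X | ∃ Vs : ℕ → Ω →ₘ[P] ℝ, (∀ n, Vs n ∈ V) ∧ Tendsto Vs atTop (@nhds _ O X)}

/-- The attainable claims `V - L^0(ℝ_+, 𝓕_T)`. -/
def attainableClaims {Ω : Type*} {mΩ : MeasurableSpace Ω} {P : Measure Ω}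
    (V : Set (Ω →ₘ[P] ℝ)) : Set (Ω →ₘ[P] ℝ) :=
  V - {Z : Ω →ₘ[P] ℝ | 0 ≤ Z}

/-- The bounded attainable claims, as a subset of `L^∞`. -/
def boundedClaims {Ω : Type*} {mΩ : MeasurableSpace Ω} {P : Measure Ω}
    (V : Set (Ω →ₘ[P] ℝ)) : Set (Lp ℝ ∞ P) :=
  {X | (X : Ω →ₘ[P] ℝ) ∈ attainableClaims V}

/-- The duality pairing `⟨X, Z⟩ = E_P[X Z]` between `L^∞` and `L^1`. -/
noncomputable def pairing {Ω : Type*} {mΩ : MeasurableSpace Ω} (P : Measure Ω) :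
    Lp ℝ ∞ P →ₗ[ℝ] Lp ℝ 1 P →ₗ[ℝ] ℝ :=
  ((ContinuousLinearMap.mul ℝ ℝ).lpPairing P ∞ 1).toLinearMap₁₂

theorem pairing_apply {Ω : Type*} {mΩ : MeasurableSpace Ω} (P : Measure Ω)
    (X : Lp ℝ ∞ P) (Z : Lp ℝ 1 P) : pairing P X Z = ∫ ω, X ω * Z ω ∂P :=
  (ContinuousLinearMap.mul ℝ ℝ).lpPairing_eq_integral X Z

/-- The weak topology `σ(L^∞, L^1)` on `L^∞`. -/
@[reducible] noncomputable def weakTopology {Ω : Type*} {mΩ : MeasurableSpace Ω} (P : Measure Ω) :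
    TopologicalSpace (Lp ℝ ∞ P) :=
  WeakBilin.instTopologicalSpace (pairing P)

/-- No Free Lunch for the terminal portfolios `V`: the `σ(L^∞, L^1)`-closure of the bounded
attainable claims meets `L^∞(ℝ_+, 𝓕_T)` only in `0`. -/
def NFL {Ω : Type*} {mΩ : MeasurableSpace Ω} {P : Measure Ω} (V : Set (Ω →ₘ[P] ℝ)) : Prop :=
  @closure _ (weakTopology P) (boundedClaims V) ∩ {X : Lp ℝ ∞ P | 0 ≤ X} = {0}

/-- There is a probability measure `Q ∼ P` with `E_Q[X] ≤ 0` for all `X ∈ V` bounded from below by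
a constant. For such `X` the expectation is well defined in `(-∞, ∞]`, and `E_Q[X] ≤ 0` means that
`X` is `Q`-integrable with nonpositive integral. -/
def HasRiskNeutralMeasure {Ω : Type*} {mΩ : MeasurableSpace Ω} {P : Measure Ω}
    (V : Set (Ω →ₘ[P] ℝ)) : Prop :=
  ∃ Q : Measure Ω, IsProbabilityMeasure Q ∧ Q ≪ P ∧ P ≪ Q ∧
    ∀ X ∈ V, (∃ c : ℝ, ∀ᵐ ω ∂P, c ≤ X ω) → Integrable X Q ∧ ∫ ω, X ω ∂Q ≤ 0

end NoFreeLunch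

namespace NoFreeLunch

/-! The cycle is 1 → 2 → 4 → 3 → 1. For 1 → 2 (Kreps–Yan), NFL keeps the indicator of each non-null
set out of the weak closure of the bounded claims. Hahn–Banach gives a separating functional, which
is an element of `L^1`; it is nonnegative because nonpositive claims are attainable. The exhaustion
`exists_ae_pos_of_forall_charges` merges these functionals into one almost surely positive density,
and truncation with Fatou extends the inequality to claims that are only bounded below. For 2 → 4
the same `Q` works. Lower bound preservation bounds the approximating portfolios below only by an
`m`-measurable `l`, but multiplying by the indicator of `{l ≥ -N}` stays in the cone and makes the
bound constant. Fatou applies for each `N`, then again as `N → ∞`. For 4 → 3, `E_Q` is weakly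
continuous, nonpositive on bounded claims and strictly positive on nonzero nonnegative ones; the
continuous-time portfolios need not form a cone. For 3 → 1, constant sequences give inclusion. -/

variable {Ω : Type*} {m mΩ : MeasurableSpace Ω} {P : Measure Ω}

/-! ### Bounded claims and cones -/

/-- A bounded claim is attainable iff it is dominated by an element of `V`. -/
theorem mem_boundedClaims_iff {V : Set (Ω →ₘ[P] ℝ)} {X : Lp ℝ ∞ P} :
    X ∈ boundedClaims V ↔ ∃ Y ∈ V, X ≤ᵐ[P] Y := by
  constructor
  · rintro ⟨Y, hY, Z, hZ, hX⟩
    refine ⟨Y, hY, ?_⟩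
    have hX' : Y - Z = (X : Ω →ₘ[P] ℝ) := hX
    have hZ' : (0 : Ω →ₘ[P] ℝ) ≤ Z := hZ
    rw [← AEEqFun.coeFn_le] at hZ'
    rw [← hX']
    filter_upwards [AEEqFun.coeFn_sub Y Z, hZ', AEEqFun.coeFn_zero (μ := P) (β := ℝ)]
      with ω h₁ h₂ h₃
    rw [h₁, Pi.sub_apply]
    rw [h₃, Pi.zero_apply] at h₂
    linarith
  · rintro ⟨Y, hY, hXY⟩
    refine ⟨Y, hY, Y - X, ?_, sub_sub_cancel _ _⟩
    change (0 : Ω →ₘ[P] ℝ) ≤ _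
    rw [← AEEqFun.coeFn_le]
    filter_upwards [AEEqFun.coeFn_sub Y X, hXY, AEEqFun.coeFn_zero (μ := P) (β := ℝ)]
      with ω h₁ h₂ h₃
    rw [h₁, h₃, Pi.sub_apply, Pi.zero_apply]
    linarith

theorem boundedClaims_mono {V W : Set (Ω →ₘ[P] ℝ)} (h : V ⊆ W) :
    boundedClaims V ⊆ boundedClaims W := by
  intro X
  simp only [mem_boundedClaims_iff]
  exact fun ⟨Y, hY, hXY⟩ => ⟨Y, h hY, hXY⟩

theorem mem_boundedClaims_of_nonpos {V : Set (Ω →ₘ[P] ℝ)} (h0 : 0 ∈ V) {X : Lp ℝ ∞ P}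
    (hX : X ≤ᵐ[P] 0) : X ∈ boundedClaims V :=
  mem_boundedClaims_iff.2 ⟨0, h0, hX.trans AEEqFun.coeFn_zero.symm.le⟩

theorem NFL.anti {V W : Set (Ω →ₘ[P] ℝ)} (h : V ⊆ W) (h0 : 0 ∈ V) (hW : NFL W) : NFL V := by
  refine Set.Subset.antisymm ?_ ?_
  · exact (Set.inter_subset_inter_left _
      (@closure_mono _ (weakTopology P) _ _ (boundedClaims_mono h))).trans hW.subset
  · rintro _ rfl
    exact ⟨@subset_closure _ (weakTopology P) _ _
      (mem_boundedClaims_of_nonpos h0 (Lp.coeFn_zero ..).le), le_refl (0 : Lp ℝ ∞ P)⟩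

theorem subset_continuousPortfolios (O : TopologicalSpace (Ω →ₘ[P] ℝ)) (V : Set (Ω →ₘ[P] ℝ)) :
    V ⊆ continuousPortfolios O V :=
  fun X hX => ⟨fun _ => X, fun _ => hX, @tendsto_const_nhds _ O _ _ _⟩

theorem IsPositiveCone.zero_mem {V : Set (Ω →ₘ[P] ℝ)}
    (hV : IsPositiveCone m V) (hne : V.Nonempty) : 0 ∈ V := by
  obtain ⟨X, hX⟩ := hne
  have h := hV.mul_mem 0
    ((aestronglyMeasurable_const (b := (0 : ℝ))).congr AEEqFun.coeFn_zero.symm) le_rfl X hX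
  have h0 : (0 : Ω →ₘ[P] ℝ) * X = 0 := by
    apply AEEqFun.ext
    filter_upwards [AEEqFun.coeFn_mul 0 X, AEEqFun.coeFn_zero (μ := P) (β := ℝ)] with ω h₁ h₂
    rw [h₁, Pi.mul_apply, h₂, Pi.zero_apply, zero_mul]
  rwa [h0] at h

theorem IsPositiveCone.smul_mem {V : Set (Ω →ₘ[P] ℝ)}
    (hV : IsPositiveCone m V) {c : ℝ} (hc : 0 ≤ c) {X : Ω →ₘ[P] ℝ} (hX : X ∈ V) :
    c • X ∈ V := by
  have h := hV.mul_mem (AEEqFun.const Ω c)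
    ((aestronglyMeasurable_const (b := c)).congr (AEEqFun.coeFn_const Ω c).symm) ?_ X hX
  · have h0 : AEEqFun.const Ω c * X = c • X := by
      apply AEEqFun.ext
      filter_upwards [AEEqFun.coeFn_mul (AEEqFun.const Ω c) X, AEEqFun.coeFn_smul c X,
        AEEqFun.coeFn_const (μ := P) Ω c] with ω h₁ h₂ h₃
      rw [h₁, h₂, Pi.mul_apply, h₃, Pi.smul_apply, smul_eq_mul, Function.const_apply]
    rwa [h0] at h
  · rw [← AEEqFun.coeFn_le]
    filter_upwards [AEEqFun.coeFn_const (μ := P) Ω c, AEEqFun.coeFn_zero (μ := P) (β := ℝ)]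
      with ω h₁ h₂
    rw [h₁, h₂]
    exact hc

theorem smul_mem_boundedClaims {V : Set (Ω →ₘ[P] ℝ)}
    (hV : IsPositiveCone m V) {c : ℝ} (hc : 0 ≤ c) {X : Lp ℝ ∞ P} (hX : X ∈ boundedClaims V) :
    c • X ∈ boundedClaims V := by
  rw [mem_boundedClaims_iff] at hX ⊢
  obtain ⟨Y, hY, hXY⟩ := hX
  refine ⟨c • Y, hV.smul_mem hc hY, ?_⟩
  filter_upwards [hXY, Lp.coeFn_smul c X, AEEqFun.coeFn_smul c Y] with ω h₁ h₂ h₃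
  rw [h₂, h₃]
  exact mul_le_mul_of_nonneg_left h₁ hc

theorem convex_boundedClaims {V : Set (Ω →ₘ[P] ℝ)} (hV : Convex ℝ V) :
    Convex ℝ (boundedClaims V) := by
  intro X hX X' hX' a b ha hb hab
  rw [mem_boundedClaims_iff] at hX hX' ⊢
  obtain ⟨Y, hY, hXY⟩ := hX
  obtain ⟨Y', hY', hXY'⟩ := hX'
  refine ⟨a • Y + b • Y', hV hY hY' ha hb hab, ?_⟩
  filter_upwards [hXY, hXY', Lp.coeFn_add (a • X) (b • X'), Lp.coeFn_smul a X,
    Lp.coeFn_smul b X', AEEqFun.coeFn_add (a • Y) (b • Y'), AEEqFun.coeFn_smul a Y,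
    AEEqFun.coeFn_smul b Y'] with ω h₁ h₂ h₃ h₄ h₅ h₆ h₇ h₈
  rw [h₃, h₆, Pi.add_apply, Pi.add_apply, h₄, h₅, h₇, h₈]
  exact add_le_add (mul_le_mul_of_nonneg_left h₁ ha) (mul_le_mul_of_nonneg_left h₂ hb)

/-! ### Fatou's lemma under a constant lower bound -/

/-- Fatou's lemma for random variables bounded below by a constant, with a bound on the
expectations. -/
theorem integrable_and_integral_nonpos_of_le_liminf {Q : Measure Ω} [IsProbabilityMeasure Q]
    {Y : Ω → ℝ} {Ys : ℕ → Ω → ℝ} {c : ℝ} (hYm : AEStronglyMeasurable Y Q)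
    (hYc : ∀ᵐ ω ∂Q, c ≤ Y ω) (hYsc : ∀ n, ∀ᵐ ω ∂Q, c ≤ Ys n ω)
    (hint : ∀ n, Integrable (Ys n) Q) (hnonpos : ∀ n, ∫ ω, Ys n ω ∂Q ≤ 0)
    (hlim : ∀ᵐ ω ∂Q, ((Y ω : ℝ) : EReal) ≤ liminf (fun n => ((Ys n ω : ℝ) : EReal)) atTop) :
    Integrable Y Q ∧ ∫ ω, Y ω ∂Q ≤ 0 := by
  have hpt : ∀ᵐ ω ∂Q, ENNReal.ofReal (Y ω - c) ≤
      liminf (fun n => ENNReal.ofReal (Ys n ω - c)) atTop := by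
    filter_upwards [hlim] with ω hω
    refine le_of_forall_lt fun a ha => ?_
    obtain ⟨b, hab, hb⟩ := exists_between ha
    refine hab.trans_le (le_liminf_of_le (by isBoundedDefault) ?_)
    have hbt : b ≠ ∞ := hb.ne_top
    have hb' : b.toReal < Y ω - c := (ENNReal.lt_ofReal_iff_toReal_lt hbt).1 hb
    have hlt : ((b.toReal + c : ℝ) : EReal) < liminf (fun n => ((Ys n ω : ℝ) : EReal)) atTop :=
      lt_of_lt_of_le (EReal.coe_lt_coe_iff.2 (by linarith)) hω
    filter_upwards [eventually_lt_of_lt_liminf hlt] with n hn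
    have hn' := EReal.coe_lt_coe_iff.1 hn
    exact (ENNReal.le_ofReal_iff_toReal_le hbt (by linarith [b.toReal_nonneg])).2 (by linarith)
  have hbound : ∀ n, ∫⁻ ω, ENNReal.ofReal (Ys n ω - c) ∂Q ≤ ENNReal.ofReal (-c) := by
    intro n
    rw [← ofReal_integral_eq_lintegral_ofReal (f := fun ω => Ys n ω - c)
      ((hint n).sub (integrable_const c))
      ((hYsc n).mono fun ω h => sub_nonneg.2 h)]
    apply ENNReal.ofReal_le_ofReal
    rw [integral_sub (hint n) (integrable_const c)]
    simpa using hnonpos n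
  have hle : ∫⁻ ω, ENNReal.ofReal (Y ω - c) ∂Q ≤ ENNReal.ofReal (-c) := by
    calc ∫⁻ ω, ENNReal.ofReal (Y ω - c) ∂Q
        ≤ ∫⁻ ω, liminf (fun n => ENNReal.ofReal (Ys n ω - c)) atTop ∂Q := lintegral_mono_ae hpt
      _ ≤ liminf (fun n => ∫⁻ ω, ENNReal.ofReal (Ys n ω - c) ∂Q) atTop :=
          lintegral_liminf_le' fun n =>
            ((hint n).aestronglyMeasurable.aemeasurable.sub_const c).ennreal_ofReal
      _ ≤ ENNReal.ofReal (-c) :=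
          liminf_le_of_le (by isBoundedDefault) fun b hb => by
            obtain ⟨n, hn⟩ := hb.exists
            exact hn.trans (hbound n)
  have hYc' : 0 ≤ᵐ[Q] fun ω => Y ω - c := hYc.mono fun ω h => sub_nonneg.2 h
  have hi : Integrable (fun ω => Y ω - c) Q :=
    ⟨hYm.sub aestronglyMeasurable_const,
      (hasFiniteIntegral_iff_ofReal hYc').2 (hle.trans_lt ENNReal.ofReal_lt_top)⟩
  have hY : Integrable Y Q :=
    (hi.add (integrable_const c)).congr (Eventually.of_forall fun ω => sub_add_cancel (Y ω) c)
  refine ⟨hY, ?_⟩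
  -- Without `c ≤ 0`, `ENNReal.ofReal (-c)` would truncate and the real inequality would be lost.
  have hc : c ≤ 0 := by
    have h := integral_mono_ae (integrable_const c) (hint 0) (hYsc 0)
    have h' := hnonpos 0
    simp only [integral_const, probReal_univ, smul_eq_mul, one_mul] at h
    linarith
  rw [← ofReal_integral_eq_lintegral_ofReal hi hYc',
    ENNReal.ofReal_le_ofReal_iff (by linarith), integral_sub hY (integrable_const c)] at hle
  simpa using hle

/-! ### Duality pairing and sufficiency of a risk-neutral measure -/

theorem continuous_pairing_left (Z : Lp ℝ 1 P) :
    @Continuous _ _ (weakTopology P) _ fun X => pairing P X Z :=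
  WeakBilin.eval_continuous (pairing P) Z

theorem ae_abs_le_norm (X : Lp ℝ ∞ P) : ∀ᵐ ω ∂P, |X ω| ≤ ‖X‖ := by
  filter_upwards [ae_le_eLpNormEssSup (f := X) (μ := P)] with ω hω
  rw [Lp.norm_def, eLpNorm_exponent_top, ← Real.norm_eq_abs, ← toReal_enorm]
  refine ENNReal.toReal_mono ?_ hω
  rw [← eLpNorm_exponent_top]
  exact Lp.eLpNorm_ne_top X

theorem integrable_of_absolutelyContinuous {Q : Measure Ω} [IsFiniteMeasure Q] (hQP : Q ≪ P)
    (X : Lp ℝ ∞ P) : Integrable X Q :=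
  Integrable.of_bound ((Lp.aestronglyMeasurable X).mono_ac hQP) ‖X‖ (hQP.ae_le (ae_abs_le_norm X))

/-- A risk-neutral measure excludes free lunches. -/
theorem HasRiskNeutralMeasure.nfl [IsProbabilityMeasure P] {V : Set (Ω →ₘ[P] ℝ)} (h0 : 0 ∈ V)
    (h : HasRiskNeutralMeasure V) : NFL V := by
  obtain ⟨Q, hQ, hQP, hPQ, hVQ⟩ := h
  have hZ : Integrable (fun ω => (Q.rnDeriv P ω).toReal) P := Measure.integrable_toReal_rnDeriv
  have hpair : ∀ X : Lp ℝ ∞ P, pairing P X hZ.toL1 = ∫ ω, X ω ∂Q := by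
    intro X
    rw [pairing_apply, ← integral_rnDeriv_smul hQP]
    refine integral_congr_ae ?_
    filter_upwards [hZ.coeFn_toL1] with ω hω
    rw [hω, smul_eq_mul, mul_comm]
  have hXint : ∀ X : Lp ℝ ∞ P, Integrable X Q := integrable_of_absolutelyContinuous hQP
  refine Set.Subset.antisymm ?_ ?_
  · rintro X ⟨hX, hX0⟩
    have hX0' : 0 ≤ᵐ[P] X := (Lp.coeFn_nonneg X).2 hX0
    have hle : ∫ ω, X ω ∂Q ≤ 0 := by
      rw [← hpair]
      have hcl : @IsClosed _ (weakTopology P) {X | pairing P X hZ.toL1 ≤ 0} :=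
        @IsClosed.preimage _ _ (weakTopology P) _ _ (continuous_pairing_left _) _ isClosed_Iic
      refine @closure_minimal _ (weakTopology P) _ _ ?_ hcl _ hX
      intro X hX
      obtain ⟨Y, hY, hXY⟩ := mem_boundedClaims_iff.1 hX
      -- A portfolio dominating a bounded claim is itself bounded below, so the hypothesis on `Q`
      -- covers it.
      have hXb : ∀ᵐ ω ∂P, -‖X‖ ≤ Y ω := by
        filter_upwards [hXY, ae_abs_le_norm X] with ω h₁ h₂
        exact (neg_le_of_abs_le h₂).trans h₁
      obtain ⟨hYi, hYn⟩ := hVQ Y hY ⟨_, hXb⟩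
      change pairing P X hZ.toL1 ≤ 0
      rw [hpair]
      exact (integral_mono_ae (hXint X) hYi (hQP.ae_le hXY)).trans hYn
    have hz : X =ᵐ[Q] 0 := (integral_eq_zero_iff_of_nonneg_ae (hQP.ae_le hX0') (hXint X)).1
      (le_antisymm hle (integral_nonneg_of_ae (hQP.ae_le hX0')))
    exact Lp.ext ((hPQ.ae_eq hz).trans (Lp.coeFn_zero ..).symm)
  · rintro _ rfl
    exact ⟨@subset_closure _ (weakTopology P) _ _
      (mem_boundedClaims_of_nonpos h0 (Lp.coeFn_zero ..).le), le_refl (0 : Lp ℝ ∞ P)⟩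

/-! ### Kreps–Yan: separation and exhaustion -/

/-- Separation of a point from the weak closure of a convex cone. -/
theorem exists_pairing_pos_of_notMem_closure {C : Set (Lp ℝ ∞ P)} (hC : Convex ℝ C)
    (h0 : 0 ∈ C) (hsmul : ∀ c : ℝ, 0 ≤ c → ∀ X ∈ C, c • X ∈ C) {X₀ : Lp ℝ ∞ P}
    (hX₀ : X₀ ∉ @closure _ (weakTopology P) C) :
    ∃ Z : Lp ℝ 1 P, (∀ X ∈ C, pairing P X Z ≤ 0) ∧ 0 < pairing P X₀ Z := by
  let C' : Set (WeakBilin (pairing P)) := C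
  let x₀ : WeakBilin (pairing P) := X₀
  have hC' : Convex ℝ C' := hC
  obtain ⟨f, u, hf, hu⟩ := geometric_hahn_banach_closed_point (E := WeakBilin (pairing P))
    hC'.closure isClosed_closure (x := x₀) hX₀
  obtain ⟨Z, rfl⟩ := LinearMap.dualEmbedding_surjective (pairing P) f
  have hf' : ∀ X ∈ C, pairing P X Z < u := fun X hX => hf X (subset_closure hX)
  have hu' : u < pairing P X₀ Z := hu
  have hu0 : 0 < u := by simpa using hf' 0 h0
  refine ⟨Z, fun X hX => ?_, hu0.trans hu'⟩
  by_contra! hpos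
  -- Rescaling a point of positive value makes the functional equal to `u`, against the strict bound
  -- on the cone.
  have h := hf' _ (hsmul (u / pairing P X Z) (by positivity) X hX)
  rw [map_smul, LinearMap.smul_apply, smul_eq_mul, div_mul_cancel₀ _ hpos.ne'] at h
  exact lt_irrefl _ h

theorem pairing_indicatorConstLp [IsFiniteMeasure P] {s : Set Ω} (hs : MeasurableSet s) (c : ℝ)
    (Z : Lp ℝ 1 P) :
    pairing P (indicatorConstLp ∞ hs (measure_ne_top P s) c) Z = c * ∫ ω in s, Z ω ∂P := by
  rw [pairing_apply, ← integral_const_mul, ← integral_indicator hs]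
  refine integral_congr_ae ?_
  filter_upwards [indicatorConstLp_coeFn (p := ∞) (hs := hs) (hμs := measure_ne_top P s) (c := c)]
    with ω hω
  rw [hω]
  by_cases h : ω ∈ s <;> simp [h]

/-- Testing against `-1` on `s` shows that every set integral of `Z` is nonnegative. -/
theorem nonneg_of_forall_pairing_nonpos [IsFiniteMeasure P] {Z : Lp ℝ 1 P}
    (hZ : ∀ X : Lp ℝ ∞ P, X ≤ᵐ[P] 0 → pairing P X Z ≤ 0) : 0 ≤ Z := by
  rw [← Lp.coeFn_nonneg]
  refine ae_nonneg_of_forall_setIntegral_nonneg (L1.integrable_coeFn Z) fun s hs _ => ?_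
  have h := hZ (indicatorConstLp ∞ hs (measure_ne_top P s) (-1)) ?_
  · rw [pairing_indicatorConstLp] at h
    linarith
  · filter_upwards [indicatorConstLp_coeFn (p := ∞) (hs := hs) (hμs := measure_ne_top P s)
      (c := (-1 : ℝ))] with ω hω
    rw [hω]
    by_cases h : ω ∈ s <;> simp [h]

/-- Exhaustion: a closed convex cone of nonnegative elements of `L^1` that charges every
non-null set contains an almost surely positive element. -/
theorem exists_ae_pos_of_forall_charges [IsFiniteMeasure P] {G : Set (Lp ℝ 1 P)}
    (hclosed : IsClosed G) (h0 : 0 ∈ G) (hadd : ∀ Z ∈ G, ∀ Z' ∈ G, Z + Z' ∈ G)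
    (hsmul : ∀ c : ℝ, 0 ≤ c → ∀ Z ∈ G, c • Z ∈ G) (hnonneg : ∀ Z ∈ G, 0 ≤ Z)
    (hcharge : ∀ s, MeasurableSet s → P s ≠ 0 → ∃ Z ∈ G, 0 < ∫ ω in s, Z ω ∂P) :
    ∃ Z ∈ G, ∀ᵐ ω ∂P, 0 < Z ω := by
  let supp : Lp ℝ 1 P → Set Ω := fun Z => {ω | 0 < Z ω}
  have hmeas : ∀ Z : Lp ℝ 1 P, MeasurableSet (supp Z) := fun Z =>
    measurableSet_lt measurable_const (Lp.stronglyMeasurable Z).measurable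
  let S : Set ℝ≥0∞ := (fun Z => P (supp Z)) '' G
  have hSne : S.Nonempty := ⟨_, 0, h0, rfl⟩
  obtain ⟨u, -, hu, huS⟩ := exists_seq_tendsto_sSup hSne (OrderTop.bddAbove S)
  choose Zs hZs hZu using huS
  -- The weights make the series absolutely convergent and, being positive, preserve supports.
  let Ws : ℕ → Lp ℝ 1 P := fun n => ((1 / 2 : ℝ) ^ n * (1 + ‖Zs n‖)⁻¹) • Zs n
  have hcoef : ∀ n, 0 < (1 / 2 : ℝ) ^ n * (1 + ‖Zs n‖)⁻¹ := fun n => by positivity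
  have hWs : ∀ n, Ws n ∈ G := fun n => hsmul _ (hcoef n).le _ (hZs n)
  have hsum : Summable Ws := by
    refine Summable.of_norm_bounded summable_geometric_two fun n => ?_
    rw [norm_smul, Real.norm_of_nonneg (hcoef n).le, mul_assoc]
    refine mul_le_of_le_one_right (by positivity) ?_
    rw [inv_mul_le_one₀ (by positivity)]
    linarith
  let W : Lp ℝ 1 P := ∑' n, Ws n
  have hfin : ∀ s : Finset ℕ, ∑ n ∈ s, Ws n ∈ G := fun s =>
    Finset.sum_induction _ (· ∈ G) (fun a b ha hb => hadd a ha b hb) h0 fun n _ => hWs n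
  have hW : W ∈ G := hclosed.mem_of_tendsto hsum.hasSum (Eventually.of_forall hfin)
  have hle : ∀ n, Ws n ≤ W := fun n => hsum.le_tsum n fun j _ => hnonneg _ (hWs j)
  have hsup : ∀ n, P (supp (Zs n)) ≤ P (supp W) := by
    intro n
    refine measure_mono_ae ?_
    filter_upwards [(Lp.coeFn_le _ _).2 (hle n),
      Lp.coeFn_smul ((1 / 2 : ℝ) ^ n * (1 + ‖Zs n‖)⁻¹) (Zs n)] with ω h₁ h₂ h₃
    have h₄ : Ws n ω = (1 / 2 : ℝ) ^ n * (1 + ‖Zs n‖)⁻¹ * Zs n ω := h₂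
    exact (mul_pos (hcoef n) h₃).trans_le (h₄ ▸ h₁)
  have hmax : ∀ Z ∈ G, P (supp Z) ≤ P (supp W) := fun Z hZ =>
    (le_sSup (Set.mem_image_of_mem _ hZ)).trans
      (le_of_tendsto' hu fun n => (hZu n).symm.le.trans (hsup n))
  refine ⟨W, hW, ?_⟩
  change P (supp W)ᶜ = 0
  by_contra hne
  obtain ⟨Z, hZ, hpos⟩ := hcharge _ (hmeas W).compl hne
  have hZ0 := (Lp.coeFn_nonneg Z).2 (hnonneg Z hZ)
  have hW0 := (Lp.coeFn_nonneg W).2 (hnonneg W hW)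
  have hsuppZ : P (supp Z \ supp W) = 0 := by
    -- `W + Z` lies in `G` and is positive on both supports, so maximality of `W` leaves no mass of
    -- `supp Z` outside `supp W`.
    have hincl : (supp W ∪ supp Z : Set Ω) ≤ᵐ[P] supp (W + Z) := by
      filter_upwards [hZ0, hW0, Lp.coeFn_add W Z] with ω h₁ h₂ h₃ h₄
      change 0 < (W + Z : Lp ℝ 1 P) ω
      rw [h₃, Pi.add_apply]
      rcases h₄ with h | h
      · exact add_pos_of_pos_of_nonneg h h₁
      · exact add_pos_of_nonneg_of_pos h₂ h
    have h := (measure_mono_ae hincl).trans (hmax _ (hadd W hW Z hZ))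
    rw [← Set.union_sdiff_self, measure_union Set.disjoint_sdiff_right
      ((hmeas Z).diff (hmeas W))] at h
    exact nonpos_iff_eq_zero.1
      ((ENNReal.add_le_add_iff_left (measure_ne_top P (supp W))).1 (by simpa using h))
  have hz : ∫ ω in (supp W)ᶜ, Z ω ∂P = 0 := by
    refine setIntegral_eq_zero_of_ae_eq_zero ?_
    filter_upwards [hZ0, measure_eq_zero_iff_ae_notMem.1 hsuppZ] with ω h₁ h₂ h₃
    exact le_antisymm (not_lt.1 fun h => h₂ ⟨h, h₃⟩) h₁
  exact hpos.ne' hz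

theorem continuous_pairing_right (X : Lp ℝ ∞ P) : Continuous fun Z => pairing P X Z :=
  ((ContinuousLinearMap.mul ℝ ℝ).lpPairing P ∞ 1 X).continuous

/-- The Kreps–Yan theorem: without free lunch there is an almost surely positive element of `L^1`
that is nonpositive on the bounded claims. -/
theorem NFL.exists_ae_pos [IsProbabilityMeasure P] {V : Set (Ω →ₘ[P] ℝ)}
    (hne : V.Nonempty) (hV : IsPositiveCone m V) (h : NFL V) :
    ∃ Z : Lp ℝ 1 P, (∀ X ∈ boundedClaims V, pairing P X Z ≤ 0) ∧ ∀ᵐ ω ∂P, 0 < Z ω := by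
  have h0 := hV.zero_mem hne
  let G : Set (Lp ℝ 1 P) := {Z | ∀ X ∈ boundedClaims V, pairing P X Z ≤ 0}
  refine exists_ae_pos_of_forall_charges (G := G) ?_ ?_ ?_ ?_ ?_ ?_
  · simp only [G, Set.ofPred_forall]
    exact isClosed_iInter fun X => isClosed_iInter fun _ =>
      isClosed_Iic.preimage (continuous_pairing_right X)
  · exact fun X _ => by rw [map_zero]
  · intro Z hZ Z' hZ' X hX
    rw [map_add]
    exact add_nonpos (hZ X hX) (hZ' X hX)
  · intro c hc Z hZ X hX
    rw [map_smul, smul_eq_mul]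
    exact mul_nonpos_of_nonneg_of_nonpos hc (hZ X hX)
  · exact fun Z hZ => nonneg_of_forall_pairing_nonpos fun X hX =>
      hZ X (mem_boundedClaims_of_nonpos h0 hX)
  · intro s hs hPs
    have hnot : indicatorConstLp ∞ hs (measure_ne_top P s) (1 : ℝ) ∉
        @closure _ (weakTopology P) (boundedClaims V) := by
      intro hmem
      have hz : indicatorConstLp ∞ hs (measure_ne_top P s) (1 : ℝ) ∈ ({0} : Set (Lp ℝ ∞ P)) := by
        rw [← h]
        refine ⟨hmem, (Lp.coeFn_nonneg _).1 ?_⟩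
        filter_upwards [indicatorConstLp_coeFn (p := ∞) (hs := hs)
          (hμs := measure_ne_top P s) (c := (1 : ℝ))] with ω hω
        rw [hω]
        exact Set.indicator_nonneg (fun _ _ => zero_le_one) ω
      have hn := norm_indicatorConstLp_top (hs := hs) (hμs := measure_ne_top P s) (c := (1 : ℝ)) hPs
      rw [Set.mem_singleton_iff.1 hz] at hn
      simp at hn
    obtain ⟨Z, hZ, hpos⟩ := exists_pairing_pos_of_notMem_closure (convex_boundedClaims hV.convex)
      (mem_boundedClaims_of_nonpos h0 (Lp.coeFn_zero ..).le)
      (fun c hc X hX => smul_mem_boundedClaims hV hc hX) hnot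
    rw [pairing_indicatorConstLp, one_mul] at hpos
    exact ⟨Z, hZ, hpos⟩

/-! ### From the positive density to a risk-neutral measure -/

/-- Absence of free lunches yields a risk-neutral measure. -/
theorem NFL.hasRiskNeutralMeasure [IsProbabilityMeasure P] {V : Set (Ω →ₘ[P] ℝ)}
    (hne : V.Nonempty) (hV : IsPositiveCone m V) (h : NFL V) :
    HasRiskNeutralMeasure V := by
  obtain ⟨Z, hZ, hpos⟩ := h.exists_ae_pos hne hV
  have hZi : Integrable Z P := L1.integrable_coeFn Z
  have hZm : Measurable Z := (Lp.stronglyMeasurable Z).measurable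
  have hI : 0 < ∫ ω, Z ω ∂P := by
    rw [integral_pos_iff_support_of_nonneg_ae (hpos.mono fun _ h => h.le) hZi]
    have : P (Function.support Z) = 1 := by
      rw [prob_compl_eq_zero_iff (Lp.stronglyMeasurable Z).measurableSet_support |>.symm]
      exact hpos.mono fun ω hω => hω.ne'
    simp [this]
  set I := ∫ ω, Z ω ∂P with hIdef
  let ρ : Ω → ℝ := fun ω => I⁻¹ * Z ω
  have hρm : Measurable ρ := hZm.const_mul _
  have hρpos : ∀ᵐ ω ∂P, 0 < ρ ω := hpos.mono fun ω hω => mul_pos (inv_pos.2 hI) hω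
  have hρi : Integrable ρ P := hZi.const_mul _
  let Q : Measure Ω := P.withDensity fun ω => ENNReal.ofReal (ρ ω)
  have hQ : IsProbabilityMeasure Q := by
    refine ⟨?_⟩
    rw [withDensity_apply _ MeasurableSet.univ, setLIntegral_univ,
      ← ofReal_integral_eq_lintegral_ofReal hρi (hρpos.mono fun _ h => h.le),
      integral_const_mul, ← hIdef, inv_mul_cancel₀ hI.ne', ENNReal.ofReal_one]
  have hQP : Q ≪ P := withDensity_absolutelyContinuous _ _
  have hPQ : P ≪ Q := withDensity_absolutelyContinuous' hρm.ennreal_ofReal.aemeasurable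
    (hρpos.mono fun ω hω => (ENNReal.ofReal_pos.2 hω).ne')
  have hQint : ∀ X : Lp ℝ ∞ P, ∫ ω, X ω ∂Q = I⁻¹ * pairing P X Z := by
    intro X
    rw [integral_withDensity_eq_integral_toReal_smul hρm.ennreal_ofReal
      (Eventually.of_forall fun _ => ENNReal.ofReal_lt_top), pairing_apply, ← integral_const_mul]
    refine integral_congr_ae ?_
    filter_upwards [hρpos] with ω hω
    rw [ENNReal.toReal_ofReal hω.le, smul_eq_mul]
    ring
  refine ⟨Q, hQ, hQP, hPQ, fun X hX ⟨c, hc⟩ => ?_⟩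
  have hXm : AEStronglyMeasurable X P := X.aestronglyMeasurable
  -- Each truncation is bounded and dominated by `X ∈ V`, hence a bounded claim.
  have hmem : ∀ n : ℕ, MemLp (fun ω => min (X ω) n) ∞ P := by
    intro n
    refine memLp_top_of_bound (hXm.inf aestronglyMeasurable_const) (|c| + n) ?_
    filter_upwards [hc] with ω hω
    have hn : (0 : ℝ) ≤ n := n.cast_nonneg
    refine abs_le.2 ⟨le_min ?_ ?_, (min_le_right _ _).trans ?_⟩
    · linarith [neg_abs_le c]
    · linarith [abs_nonneg c]
    · linarith [abs_nonneg c]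
  have hcoe : ∀ n : ℕ, (hmem n).toLp =ᵐ[Q] fun ω => min (X ω) n := fun n =>
    hQP.ae_eq (hmem n).coeFn_toLp
  -- The bound is `min c 0` because the truncation level `n = 0` may lie below `c`.
  refine integrable_and_integral_nonpos_of_le_liminf (c := min c 0)
    (Ys := fun n ω => min (X ω) n) (hXm.mono_ac hQP)
    (hQP.ae_le (hc.mono fun ω hω => (min_le_left _ _).trans hω)) ?_ ?_ ?_ ?_
  · exact fun n => hQP.ae_le (hc.mono fun ω hω => min_le_min hω n.cast_nonneg)
  · exact fun n => (integrable_of_absolutelyContinuous hQP _).congr (hcoe n)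
  · intro n
    rw [← integral_congr_ae (hcoe n), hQint]
    refine mul_nonpos_of_nonneg_of_nonpos (inv_nonneg.2 hI.le)
      (hZ _ (mem_boundedClaims_iff.2 ⟨X, hX, ?_⟩))
    filter_upwards [(hmem n).coeFn_toLp] with ω hω
    rw [hω]
    exact min_le_left _ _
  · refine Eventually.of_forall fun ω => le_liminf_of_le (by isBoundedDefault) ?_
    filter_upwards [eventually_ge_atTop ⌈X ω⌉₊] with n hn
    rw [min_eq_left (Nat.ceil_le.1 hn)]

/-! ### Passage to continuous-time portfolios -/

/-- A risk-neutral measure for the discrete-time portfolios is one for the continuous-time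
portfolios. -/
theorem HasRiskNeutralMeasure.continuousPortfolios (hm : m ≤ mΩ)
    {O : TopologicalSpace (Ω →ₘ[P] ℝ)} (hFatou : FatouProperty O)
    (hHom : PositivelyHomogeneous m O) (hLow : LowerBoundPreserving m O)
    {V : Set (Ω →ₘ[P] ℝ)}
    (hV : IsPositiveCone m V) (h : HasRiskNeutralMeasure V) :
    HasRiskNeutralMeasure (continuousPortfolios O V) := by
  obtain ⟨Q, hQ, hQP, hPQ, hVQ⟩ := h
  refine ⟨Q, hQ, hQP, hPQ, ?_⟩
  rintro X ⟨Xs, hXs, hlim⟩ ⟨c, hc⟩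
  obtain ⟨k, hk, l, ⟨l', hl'm, hll'⟩, hl⟩ := hLow X ⟨AEEqFun.const Ω c,
    (aestronglyMeasurable_const (b := c)).congr (AEEqFun.coeFn_const Ω c).symm, by
      rw [← AEEqFun.coeFn_le]
      filter_upwards [AEEqFun.coeFn_const (μ := P) Ω c, hc] with ω h₁ h₂
      rw [h₁]
      exact h₂⟩ Xs hlim
  have hlimk := hlim.comp hk.tendsto_atTop
  -- The `m`-measurable representative `l'` is used so that `A N` lies in `m` and its indicator is
  -- an admissible multiplier.
  let A : ℕ → Set Ω := fun N => {ω | -(N : ℝ) ≤ l' ω}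
  have hA : ∀ N, MeasurableSet[m] (A N) := fun N => hl'm.measurable measurableSet_Ici
  let α : ℕ → Ω →ₘ[P] ℝ := fun N => AEEqFun.mk ((A N).indicator fun _ => (1 : ℝ))
    (aestronglyMeasurable_const.indicator (hm _ (hA N)))
  have hα : ∀ N, α N =ᵐ[P] (A N).indicator fun _ => (1 : ℝ) := fun N => AEEqFun.coeFn_mk _ _
  have hαm : ∀ N, MeasurableClass m (α N) := fun N =>
    ⟨_, (@stronglyMeasurable_const _ _ m _ _).indicator (hA N), hα N⟩
  have hα0 : ∀ N, 0 ≤ α N := by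
    intro N
    rw [← AEEqFun.coeFn_le]
    filter_upwards [hα N, AEEqFun.coeFn_zero (μ := P) (β := ℝ)] with ω h₁ h₂
    rw [h₁, h₂]
    exact Set.indicator_nonneg (fun _ _ => zero_le_one) ω
  have hmul : ∀ N (Y : Ω →ₘ[P] ℝ), ⇑(α N * Y) =ᵐ[P] (A N).indicator Y := by
    intro N Y
    filter_upwards [AEEqFun.coeFn_mul (α N) Y, hα N] with ω h₁ h₂
    rw [h₁, Pi.mul_apply, h₂]
    by_cases h : ω ∈ A N <;> simp [h]
  have hcut : ∀ (N : ℕ) (Y : Ω →ₘ[P] ℝ), l ≤ Y → ∀ᵐ ω ∂P, -(N : ℝ) ≤ (α N * Y) ω := by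
    intro N Y hY
    filter_upwards [hmul N Y, AEEqFun.coeFn_le.2 hY, hll'] with ω h₁ h₂ h₃
    rw [h₁]
    by_cases h : ω ∈ A N
    · rw [Set.indicator_of_mem h]
      exact (show -(N : ℝ) ≤ l' ω from h).trans (h₃ ▸ h₂)
    · simp [h]
  have hXcut : ∀ N, ∀ᵐ ω ∂P, min c 0 ≤ (α N * X) ω := by
    intro N
    filter_upwards [hmul N X, hc] with ω h₁ h₂
    rw [h₁]
    by_cases h : ω ∈ A N <;> simp [h, h₂]
  have hstep : ∀ N, Integrable (α N * X : Ω →ₘ[P] ℝ) Q ∧ ∫ ω, (α N * X) ω ∂Q ≤ 0 := by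
    intro N
    obtain ⟨j, -, hj⟩ := hFatou _ _ (hHom _ _ hlimk (α N) (hαm N) (hα0 N))
    have hYV := fun n => hVQ _ (hV.mul_mem (α N) (hαm N) (hα0 N) _ (hXs (k (j n))))
      ⟨_, hcut N _ (hl (j n))⟩
    refine integrable_and_integral_nonpos_of_le_liminf (c := min (-(N : ℝ)) (min c 0))
      (Ys := fun n => (α N * Xs (k (j n)) : Ω →ₘ[P] ℝ))
      ((α N * X).aestronglyMeasurable.mono_ac hQP) ?_ ?_
      (fun n => (hYV n).1) (fun n => (hYV n).2) (hQP.ae_le hj)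
    · exact hQP.ae_le ((hXcut N).mono fun ω h => (min_le_right _ _).trans h)
    · exact fun n => hQP.ae_le ((hcut N _ (hl (j n))).mono fun ω h => (min_le_left _ _).trans h)
  -- For `N → ∞` the bound comes from `X ≥ c` and is uniform in `N`; since `l'` is finite, every
  -- point eventually enters `A N`.
  refine integrable_and_integral_nonpos_of_le_liminf (c := min c 0)
    (Ys := fun N => (α N * X : Ω →ₘ[P] ℝ)) (X.aestronglyMeasurable.mono_ac hQP)
    (hQP.ae_le (hc.mono fun ω h => (min_le_left _ _).trans h)) (fun N => hQP.ae_le (hXcut N))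
    (fun N => (hstep N).1) (fun N => (hstep N).2) (hQP.ae_le ?_)
  filter_upwards [ae_all_iff.2 fun N => hmul N X] with ω hω
  refine le_liminf_of_le (by isBoundedDefault) ?_
  filter_upwards [eventually_ge_atTop ⌈-l' ω⌉₊] with N hN
  have hmem : ω ∈ A N := neg_le.1 (Nat.ceil_le.1 hN)
  rw [hω N, Set.indicator_of_mem hmem]

end NoFreeLunch

theorem proposition3p2 {Ω : Type*} {mΩ : MeasurableSpace Ω} (P : Measure Ω)
    [IsProbabilityMeasure P] {T : ℝ} (hT : 0 < T)
    (ℱ : Filtration (Set.Icc (0 : ℝ) T) mΩ) (hℱT : ℱ ⟨T, hT.le, le_rfl⟩ = mΩ)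
    (t : Set.Icc (0 : ℝ) T)
    (O : TopologicalSpace (Ω →ₘ[P] ℝ))
    (hFatou : NoFreeLunch.FatouProperty O)
    (hHom : NoFreeLunch.PositivelyHomogeneous (ℱ t) O)
    (hLow : NoFreeLunch.LowerBoundPreserving (ℱ t) O)
    (V : Set (Ω →ₘ[P] ℝ)) (hne : V.Nonempty)
    (hV : NoFreeLunch.IsPositiveCone (ℱ t) V) :
    List.TFAE
      [NoFreeLunch.NFL V,
       NoFreeLunch.HasRiskNeutralMeasure V,
       NoFreeLunch.NFL (NoFreeLunch.continuousPortfolios O V),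
       NoFreeLunch.HasRiskNeutralMeasure (NoFreeLunch.continuousPortfolios O V)] := by
  have h0 := hV.zero_mem hne
  have hsub := NoFreeLunch.subset_continuousPortfolios O V
  tfae_have 1 → 2 := fun h => h.hasRiskNeutralMeasure hne hV
  tfae_have 2 → 4 := fun h => h.continuousPortfolios (ℱ.le t) hFatou hHom hLow hV
  tfae_have 4 → 3 := fun h => h.nfl (hsub h0)
  tfae_have 3 → 1 := fun h => h.anti hsub h0
  tfae_finish
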